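/- Let $\mathcal X\subseteq\mathbb R^n$ be path-connected with $0\in\mathcal X$, let $\mathcal U\subseteq\mathbb R^m$, let $\mathcal D\subseteq\mathbb R^p$ with $0\in\mathcal D$, and let $f:\mathcal X\times\mathcal U\times\mathcal D\to\mathbb R^n$ be locally Lipschitz. Class $\mathcal K_\infty$ consists of the continuous, strictly increasing, unbounded functions $\mathbb R_+\to\mathbb R_+$ vanishing at $0$; class $\mathcal{KL}_\infty$ consists of the continuous $\beta:\mathbb R_+\times\mathbb R_+\to\mathbb R_+$ with $\beta(\cdot,s)\in\mathcal K_\infty$ for every $s$ and $\beta(r,\cdot)$ non-increasing with limit $0$ at infinity for every $r$. Suppose that $V:\mathcal X\to\mathbb R_+$ is a control Lyapunov function (CLF) on $\mathcal X$ for the undisturbed system $\dot x=f(x,u,0)$: $V$ is continuously differentiable (on a neighbourhood of $\mathcal X$) and there are $\underline\alpha,\overline\alpha,\alpha\in\mathcal K_\infty$ with $$\underline\alpha(\|x\|)\le V(x)\le\overline\alpha(\|x\|),\qquad \inf_{u\in\mathcal U}\nabla V(x)^\top f(x,u,0)\le-\alpha(\|x\|)\qquad\text{for all }x\in\mathcal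 X.$$ Then the disturbed system $\dot x=f(x,u,d)$ is projection to state stable (PSS) with respect to the scalar projection $V$. That is: $V$ is a dynamic projection (it is continuously differentiable and $\underline\sigma(\|x\|)\le|V(x)|\le\overline\sigma(\|x\|)$ on $\mathcal X$ for some $\underline\sigma,\overline\sigma\in\mathcal K_\infty$), its projected disturbance is $\delta=\nabla V(x)^\top\big(f(x,u,d)-f(x,u,0)\big)$, and there is a state-feedback controller $k:\mathcal X\to\mathcal U$ for which there exist $\beta\in\mathcal{KL}_\infty$ and $\gamma\in\mathcal K_\infty$ such that every (Carathéodory) solution $x:[0,T)\to\mathcal X$, $0<T\le\infty$, of $\dot x(t)=f(x(t),k(x(t)),d(t))$, with a disturbance $d:[0,T)\to\mathcal D$ such that $d$ and $\delta(t)=\nabla V(x(t))^\top\big(f(x(t),k(x(t)),d(t))-f(x(t),k(x(t)),0)\big)$ are essentially bounded, satisfies $$\|x(t)\|\le\beta(\|x(0)\|,t)+\gamma\Big(\operatorname*{ess\,sup}_{0\le\tau<T}|\delta(\tau)|\Big)\qquad\text{for all }t\in[0,T).$$ More precisely, there is a controller $k:\mathcal X\to\mathcal U$ with the following property, and every controller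 with this property makes the system PSS in the above sense: for some $\alpha'\in\mathcal K_\infty$, $\nabla V(x)^\top f(x,k(x),0)\le-\alpha'(\|x\|)$ for all nonzero $x\in\mathcal X$. -/

import Mathlib

open Set Filter Topology MeasureTheory

/-- Class `K_∞`: continuous, strictly increasing and unbounded functions on `[0, ∞)` that vanish
at `0` (hence with values in `[0, ∞)`). Only the values on `[0, ∞)` matter. -/
structure IsClassKInf (α : ℝ → ℝ) : Prop where
  continuousOn : ContinuousOn α (Ici 0)
  strictMonoOn : StrictMonoOn α (Ici 0)
  map_zero : α 0 = 0
  tendsto_atTop : Tendsto α atTop atTop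

/-- Class `KL_∞`: continuous functions `β` on `[0, ∞) × [0, ∞)` such that `β(·, s)` is of class
`K_∞` for every `s ≥ 0`, and `β(r, ·)` is non-increasing with limit `0` for every `r ≥ 0`. -/
structure IsClassKLInf (β : ℝ → ℝ → ℝ) : Prop where
  continuousOn : ContinuousOn (fun p : ℝ × ℝ => β p.1 p.2) (Ici 0 ×ˢ Ici 0)
  classKInf : ∀ s, 0 ≤ s → IsClassKInf (fun r => β r s)
  antitoneOn : ∀ r, 0 ≤ r → AntitoneOn (β r) (Ici 0)
  tendsto_zero : ∀ r, 0 ≤ r → Tendsto (β r) atTop (𝓝 0)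

section Systems

variable {E F G P : Type*}
  [NormedAddCommGroup E] [NormedSpace ℝ E] [NormedAddCommGroup F] [NormedSpace ℝ F]
  [NormedAddCommGroup G] [NormedSpace ℝ G] [NormedAddCommGroup P] [NormedSpace ℝ P]

/-- `V` is continuously differentiable on `X` (that is, on an open neighbourhood of `X`). -/
def IsC1On (X : Set E) (V : E → P) : Prop := ∀ x ∈ X, ContDiffAt ℝ 1 V x

/-- `V` is a control Lyapunov function on `X` for `ẋ = g(x, u)` with inputs `u ∈ U`. The infimum is
taken in the extended reals, so it may be `-∞`. -/
def IsCLF (X : Set E) (U : Set F) (g : E → F → E) (V : E → ℝ) : Prop :=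
  IsC1On X V ∧ (∀ x ∈ X, 0 ≤ V x) ∧
  ∃ αlow αup α : ℝ → ℝ, IsClassKInf αlow ∧ IsClassKInf αup ∧ IsClassKInf α ∧
    ∀ x ∈ X, αlow ‖x‖ ≤ V x ∧ V x ≤ αup ‖x‖ ∧
      (⨅ u ∈ U, ((fderiv ℝ V x (g x u) : ℝ) : EReal)) ≤ ((-α ‖x‖ : ℝ) : EReal)

/-- A dynamic projection on `X`. -/
def IsDynamicProjection (X : Set E) (Pr : E → P) : Prop :=
  IsC1On X Pr ∧
  ∃ σlow σup : ℝ → ℝ, IsClassKInf σlow ∧ IsClassKInf σup ∧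
    ∀ x ∈ X, σlow ‖x‖ ≤ ‖Pr x‖ ∧ ‖Pr x‖ ≤ σup ‖x‖

/-- The projected disturbance `δ = D_Π(x) (f(x, u, d) - f(x, u, 0))`. -/
noncomputable def projDisturbance (f : E → F → G → E) (Pr : E → P) (x : E) (u : F) (d : G) : P :=
  fderiv ℝ Pr x (f x u d - f x u 0)

/-- The time interval `[0, T)`, where `T` may be `∞`. -/
def timeInterval (T : EReal) : Set ℝ := {t : ℝ | 0 ≤ t ∧ (t : EReal) < T}

/-- `x` is a (Carathéodory) solution on `[0, T)`, with values in `X`, of the closed loop system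
`ẋ = f(x, k(x), d)` for the disturbance signal `d` with values in `D`. A disturbance that depends
on time, state and input is covered, `d` being its value along the solution. -/
structure IsSolution (X : Set E) (D : Set G) (f : E → F → G → E) (k : E → F)
    (T : EReal) (x : ℝ → E) (d : ℝ → G) : Prop where
  mem_state : ∀ t ∈ timeInterval T, x t ∈ X
  mem_dist : ∀ t ∈ timeInterval T, d t ∈ D
  absCont : ∀ t ∈ timeInterval T, AbsolutelyContinuousOnInterval x 0 t
  hasDerivAt : ∀ᵐ t ∂(volume.restrict (timeInterval T)), HasDerivAt x (f (x t) (k (x t)) (d t)) t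

/-- The essential supremum of `‖w(t)‖` over `t ∈ [0, T)`, in `[0, ∞]`. -/
noncomputable def essSupNorm (T : EReal) (w : ℝ → P) : ENNReal :=
  essSup (fun t => ‖w t‖ₑ) (volume.restrict (timeInterval T))

/-- With the feedback `k`, the disturbed system `ẋ = f(x, k(x), d)` is projection to state stable
with respect to `Pr`. Here `d` and the projected disturbance are essentially bounded in time. -/
def IsPSS (X : Set E) (D : Set G) (f : E → F → G → E) (k : E → F) (Pr : E → P) : Prop :=
  ∃ (β : ℝ → ℝ → ℝ) (γ : ℝ → ℝ), IsClassKLInf β ∧ IsClassKInf γ ∧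
    ∀ (T : EReal) (x : ℝ → E) (d : ℝ → G), IsSolution X D f k T x d →
      essSupNorm T d < ⊤ →
      essSupNorm T (fun τ => projDisturbance f Pr (x τ) (k (x τ)) (d τ)) < ⊤ →
      ∀ t ∈ timeInterval T,
        ‖x t‖ ≤ β ‖x 0‖ t +
          γ (essSupNorm T (fun τ => projDisturbance f Pr (x τ) (k (x τ)) (d τ))).toReal

/-- `k : X → U` is a state feedback controller that makes `V` decrease along `ẋ = g(x, k(x))` at a
class `K_∞` rate, at every nonzero state. -/
def IsCLFController (X : Set E) (U : Set F) (g : E → F → E) (V : E → ℝ) (k : E → F) : Prop :=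
  MapsTo k X U ∧ ∃ α : ℝ → ℝ, IsClassKInf α ∧
    ∀ x ∈ X, x ≠ 0 → fderiv ℝ V x (g x (k x)) ≤ -α ‖x‖

end Systems

/-! Along a solution, V' = ∇V·f(x,k,0) + δ ≤ -ρ(V) + ‖δ‖∞ almost everywhere where V > 0, with ρ = α
∘ αup⁻¹ for the decay rate α of `k`. Above the level M = ρ⁻¹(2‖δ‖∞) the disturbance costs at most
half the decay, so V' ≤ -ρ(V)/2. Either V has reached M and cannot cross it upwards again, or it has
stayed above M and decays at a `KL_∞` rate (`IsClassKInf.exists_comparison`). Applying αlow⁻¹ turns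
this into the bound on ‖x‖ (`IsCLF.isPSS`). The rate comes from a change of variable rather than
from solving v' = -ρ(v): if η'ρ ≥ 1, then η(v) falls at least at unit speed
(`IsClassKInf.exists_decay`). -/

/-! ### Comparison functions. -/

namespace IsClassKInf

variable {a b : ℝ → ℝ}

theorem nonneg (ha : IsClassKInf a) {r : ℝ} (hr : 0 ≤ r) : 0 ≤ a r := by
  have := ha.strictMonoOn.monotoneOn (mem_Ici.2 le_rfl) (mem_Ici.2 hr) hr
  rwa [ha.map_zero] at this

theorem pos (ha : IsClassKInf a) {r : ℝ} (hr : 0 < r) : 0 < a r := by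
  have := ha.strictMonoOn (mem_Ici.2 le_rfl) (mem_Ici.2 hr.le) hr
  rwa [ha.map_zero] at this

theorem mono (ha : IsClassKInf a) {r s : ℝ} (hr : 0 ≤ r) (hrs : r ≤ s) : a r ≤ a s :=
  ha.strictMonoOn.monotoneOn (mem_Ici.2 hr) (mem_Ici.2 (hr.trans hrs)) hrs

theorem mapsTo (ha : IsClassKInf a) : MapsTo a (Ici 0) (Ici 0) := fun _ hr => ha.nonneg hr

theorem comp (ha : IsClassKInf a) (hb : IsClassKInf b) : IsClassKInf (fun r => a (b r)) where
  continuousOn := ha.continuousOn.comp hb.continuousOn hb.mapsTo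
  strictMonoOn := ha.strictMonoOn.comp hb.strictMonoOn hb.mapsTo
  map_zero := by rw [hb.map_zero, ha.map_zero]
  tendsto_atTop := ha.tendsto_atTop.comp hb.tendsto_atTop

theorem id : IsClassKInf (fun r => r) :=
  ⟨continuousOn_id, strictMono_id.strictMonoOn _, rfl, tendsto_id⟩

theorem const_mul (ha : IsClassKInf a) {c : ℝ} (hc : 0 < c) : IsClassKInf (fun r => c * a r) where
  continuousOn := continuousOn_const.mul ha.continuousOn
  strictMonoOn := fun _ hr _ hs h => mul_lt_mul_of_pos_left (ha.strictMonoOn hr hs h) hc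
  map_zero := by rw [ha.map_zero, mul_zero]
  tendsto_atTop := ha.tendsto_atTop.const_mul_atTop hc

/-- A class `K_∞` function has an inverse on `[0, ∞)`, which is of class `K_∞`. -/
theorem exists_inverse (ha : IsClassKInf a) :
    ∃ b : ℝ → ℝ, IsClassKInf b ∧ (∀ r, 0 ≤ r → b (a r) = r) ∧ ∀ r, 0 ≤ r → a (b r) = r := by
  -- Extending `a` by the identity on the negative axis gives an increasing bijection of the line,
  -- whose inverse is automatically continuous.
  set g : ℝ → ℝ := fun r => a (max r 0) + min r 0 with hg
  have g_of_nonneg : ∀ r, 0 ≤ r → g r = a r := fun r hr => by simp [hg, hr]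
  have g_of_nonpos : ∀ r, r ≤ 0 → g r = r := fun r hr => by simp [hg, hr, ha.map_zero]
  have hcont : Continuous g := by
    refine Continuous.add ?_ (by fun_prop)
    exact ha.continuousOn.comp_continuous (by fun_prop) fun r => le_max_right r 0
  have hmono : StrictMono g := by
    intro r s hrs
    rcases le_or_gt 0 r with hr | hr
    · rw [g_of_nonneg r hr, g_of_nonneg s (hr.trans hrs.le)]
      exact ha.strictMonoOn hr (hr.trans hrs.le) hrs
    · rw [g_of_nonpos r hr.le]
      rcases le_or_gt 0 s with hs | hs
      · rw [g_of_nonneg s hs]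
        exact hr.trans_le (ha.nonneg hs)
      · rwa [g_of_nonpos s hs.le]
  have hsurj : Function.Surjective g := by
    refine hcont.surjective ?_ ?_
    · refine ha.tendsto_atTop.congr' ?_
      filter_upwards [eventually_ge_atTop 0] with r hr using (g_of_nonneg r hr).symm
    · refine tendsto_id.congr' ?_
      filter_upwards [eventually_le_atBot 0] with r hr using (g_of_nonpos r hr).symm
  let e : ℝ ≃o ℝ := hmono.orderIsoOfSurjective g hsurj
  have he : ∀ r, e r = g r := fun _ => rfl
  have e_zero : e.symm 0 = 0 := by rw [e.symm_apply_eq, he, g_of_nonneg 0 le_rfl, ha.map_zero]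
  have e_nonneg : ∀ r, 0 ≤ r → 0 ≤ e.symm r := fun r hr => by
    rw [← e_zero]; exact e.symm.monotone hr
  refine ⟨e.symm, ⟨e.symm.continuous.continuousOn, e.symm.strictMono.strictMonoOn _, e_zero,
    e.symm.tendsto_atTop⟩, fun r hr => ?_, fun r hr => ?_⟩
  · rw [e.symm_apply_eq, he, g_of_nonneg r hr]
  · rw [← g_of_nonneg _ (e_nonneg r hr), ← he, e.apply_symm_apply]

end IsClassKInf

theorem IsClassKLInf.comp {a b : ℝ → ℝ} {β : ℝ → ℝ → ℝ} (hβ : IsClassKLInf β)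
    (ha : IsClassKInf a) (hb : IsClassKInf b) : IsClassKLInf (fun r t => a (β (b r) t)) where
  continuousOn := by
    refine ha.continuousOn.comp (hβ.continuousOn.comp (f := fun p : ℝ × ℝ => (b p.1, p.2)) ?_ ?_) ?_
    · exact (hb.continuousOn.comp continuousOn_fst fun p hp => hp.1).prodMk continuousOn_snd
    · exact fun p hp => ⟨hb.nonneg hp.1, hp.2⟩
    · exact fun p hp => (hβ.classKInf p.2 hp.2).nonneg (hb.nonneg hp.1)
  classKInf := fun s hs => ha.comp ((hβ.classKInf s hs).comp hb)
  antitoneOn := fun r hr s hs t ht hst =>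
    ha.mono ((hβ.classKInf t ht).nonneg (hb.nonneg hr)) (hβ.antitoneOn _ (hb.nonneg hr) hs ht hst)
  tendsto_zero := fun r hr => by
    have h0 : Tendsto a (𝓝[Ici 0] 0) (𝓝 0) := by
      simpa only [ContinuousWithinAt, ha.map_zero] using ha.continuousOn 0 (mem_Ici.2 le_rfl)
    refine h0.comp (tendsto_nhdsWithin_iff.2 ⟨hβ.tendsto_zero _ (hb.nonneg hr), ?_⟩)
    filter_upwards [eventually_ge_atTop 0] with t ht
    exact (hβ.classKInf t ht).nonneg (hb.nonneg hr)

/-- An order isomorphism `H` of the line gives the class `KL_∞` function `exp (H⁻¹ (H (log r) - t))`. -/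
theorem isClassKLInf_exp_symm (e : ℝ ≃o ℝ) :
    IsClassKLInf fun r t => if r ≤ 0 then 0 else Real.exp (e.symm (e (Real.log r) - t)) := by
  set β : ℝ → ℝ → ℝ := fun r t => if r ≤ 0 then 0 else Real.exp (e.symm (e (Real.log r) - t))
    with hβ
  have β_zero : ∀ t, β 0 t = 0 := fun t => by simp [hβ]
  have β_pos : ∀ r t, 0 < r → β r t = Real.exp (e.symm (e (Real.log r) - t)) :=
    fun r t hr => by simp [hβ, hr]
  have β_nonneg : ∀ r t, 0 ≤ β r t := fun r t => by
    simp only [hβ]; split_ifs <;> positivity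
  have β_le : ∀ r t, 0 ≤ r → 0 ≤ t → β r t ≤ r := fun r t hr ht => by
    rcases hr.eq_or_lt with rfl | hr
    · rw [β_zero]
    · rw [β_pos r t hr]
      refine (Real.exp_le_exp.2 (e.symm.monotone (sub_le_self _ ht))).trans ?_
      rw [e.symm_apply_apply, Real.exp_log hr]
  have hcont : ContinuousOn (fun p : ℝ × ℝ => β p.1 p.2) (Ici 0 ×ˢ Ici 0) := by
    rintro ⟨r, t⟩ ⟨hr, ht⟩
    -- The formula with `log` says nothing at r = 0; continuity there is a squeeze between 0 and r.
    rcases (mem_Ici.1 hr).eq_or_lt with h | h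
    · obtain rfl : r = 0 := h.symm
      simp only [ContinuousWithinAt, β_zero]
      refine tendsto_of_tendsto_of_tendsto_of_le_of_le' tendsto_const_nhds
        (h := fun p : ℝ × ℝ => p.1) ?_ (Eventually.of_forall fun p => β_nonneg _ _) ?_
      · exact (continuous_fst.tendsto ((0 : ℝ), t)).mono_left nhdsWithin_le_nhds
      · filter_upwards [self_mem_nhdsWithin] with p hp using β_le _ _ hp.1 hp.2
    · refine ContinuousAt.continuousWithinAt ?_
      have hc : ContinuousAt
          (fun p : ℝ × ℝ => Real.exp (e.symm (e (Real.log p.1) - p.2))) (r, t) := by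
        have hl : ContinuousAt (fun p : ℝ × ℝ => Real.log p.1) (r, t) :=
          continuousAt_fst.log h.ne'
        exact (e.symm.continuous.continuousAt.comp
          ((e.continuous.continuousAt.comp hl).sub continuousAt_snd)).rexp
      refine hc.congr ?_
      filter_upwards [continuousAt_fst.eventually (lt_mem_nhds h)] with p hp
      exact (β_pos _ _ hp).symm
  refine ⟨hcont, fun s hs => ⟨?_, ?_, β_zero s, ?_⟩, fun r hr s _ t _ hst => ?_, fun r hr => ?_⟩
  · exact hcont.comp (f := fun r => (r, s)) (by fun_prop) fun r hr => ⟨hr, hs⟩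
  · intro r hr r' _ hrr'
    have hr' : 0 < r' := (mem_Ici.1 hr).trans_lt hrr'
    change β r s < β r' s
    rw [β_pos r' s hr']
    rcases (mem_Ici.1 hr).eq_or_lt with h | h
    · rw [← h, β_zero]
      exact Real.exp_pos _
    · rw [β_pos r s h]
      exact Real.exp_lt_exp.2 (e.symm.strictMono
        (sub_lt_sub_right (e.strictMono (Real.log_lt_log h hrr')) s))
  · have : Tendsto (fun r => Real.exp (e.symm (e (Real.log r) - s))) atTop atTop :=
      Real.tendsto_exp_atTop.comp (e.symm.tendsto_atTop.comp
        (tendsto_atTop_add_const_right _ (-s) (e.tendsto_atTop.comp Real.tendsto_log_atTop)))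
    refine this.congr' ?_
    filter_upwards [eventually_gt_atTop 0] with r hr using (β_pos r s hr).symm
  · rcases (show 0 ≤ r from hr).eq_or_lt with h | h
    · rw [← h, β_zero, β_zero]
    · rw [β_pos r s h, β_pos r t h]
      exact Real.exp_le_exp.2 (e.symm.monotone (sub_le_sub_left hst _))
  · rcases hr.eq_or_lt with h | h
    · have : β r = fun _ => 0 := funext fun t => by rw [← h, β_zero]
      rw [this]
      exact tendsto_const_nhds
    · have h1 : Tendsto (fun t => Real.exp (e.symm (e (Real.log r) - t))) atTop (𝓝 0) := by
        refine Real.tendsto_exp_atBot.comp (e.symm.tendsto_atBot.comp ?_)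
        exact tendsto_atBot_add_const_left _ _ tendsto_neg_atTop_atBot
      exact h1.congr fun t => (β_pos r t h).symm

/-- For the decay rate `ρ` there are a `C¹` function `η` on `(0, ∞)`, which decreases at least at
rate `1` along `v' ≤ -ρ(v)`, and a class `KL_∞` bound for the functions `v` with this property. -/
theorem IsClassKInf.exists_decay {ρ : ℝ → ℝ} (hρ : IsClassKInf ρ) :
    ∃ (η : ℝ → ℝ) (β : ℝ → ℝ → ℝ), IsClassKLInf β ∧
      (∀ s, 0 < s → ContDiffAt ℝ 1 η s) ∧
      (∀ s, 0 < s → 0 < deriv η s ∧ 1 ≤ deriv η s * ρ s) ∧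
      ∀ r s t, 0 < r → 0 < s → η s ≤ η r - t → s ≤ β r t := by
  -- In the variable y = log s, η is an antiderivative of 1 / min(ρ(s), s). Capping ρ(s) by s makes
  -- `h ≥ 1`, so `H` is onto the line and can be inverted at every `H y - t`.
  set q : ℝ → ℝ := fun y => min (ρ (Real.exp y)) (Real.exp y) with hq
  have q_pos : ∀ y, 0 < q y := fun y => lt_min (hρ.pos (Real.exp_pos y)) (Real.exp_pos y)
  have q_cont : Continuous q :=
    (hρ.continuousOn.comp_continuous Real.continuous_exp fun y => (Real.exp_pos y).le).min
      Real.continuous_exp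
  set h : ℝ → ℝ := fun y => Real.exp y / q y with hh
  have h_cont : Continuous h := Real.continuous_exp.div q_cont fun y => (q_pos y).ne'
  have one_le_h : ∀ y, 1 ≤ h y := fun y => (one_le_div (q_pos y)).2 (min_le_right _ _)
  set H : ℝ → ℝ := fun y => ∫ z in (0 : ℝ)..y, h z with hH
  have H_deriv : ∀ y, HasDerivAt H (h y) y := fun y => h_cont.integral_hasStrictDerivAt 0 y
    |>.hasDerivAt
  have H_contDiff : ContDiff ℝ 1 H := by
    rw [contDiff_one_iff_deriv]
    refine ⟨fun y => (H_deriv y).differentiableAt, ?_⟩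
    rwa [show deriv H = h from funext fun y => (H_deriv y).deriv]
  have H_mono : StrictMono H := strictMono_of_deriv_pos fun y => by
    rw [(H_deriv y).deriv]
    exact one_pos.trans_le (one_le_h y)
  have H_sub_mono : Monotone fun y => H y - y := by
    refine monotone_of_deriv_nonneg (fun y => ((H_deriv y).sub (hasDerivAt_id y)).differentiableAt)
      fun y => ?_
    rw [((H_deriv y).fun_sub (hasDerivAt_id' y)).deriv]
    exact sub_nonneg.2 (one_le_h y)
  have H_zero : H 0 = 0 := by simp [hH]
  have H_surj : Function.Surjective H := by
    refine H_contDiff.continuous.surjective ?_ ?_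
    · refine tendsto_atTop_mono' _ ?_ tendsto_id
      filter_upwards [eventually_ge_atTop 0] with y hy
      have := H_sub_mono hy
      simp only [H_zero, sub_zero] at this
      exact sub_nonneg.1 this
    · refine tendsto_atBot_mono' _ ?_ tendsto_id
      filter_upwards [eventually_le_atBot 0] with y hy
      have := H_sub_mono hy
      simp only [H_zero, sub_zero] at this
      exact sub_nonpos.1 this
  let e : ℝ ≃o ℝ := H_mono.orderIsoOfSurjective H H_surj
  refine ⟨fun s => H (Real.log s), _, isClassKLInf_exp_symm e, fun s hs => ?_, fun s hs => ?_,
    fun r s t hr hs hrst => ?_⟩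
  · exact H_contDiff.contDiffAt.comp s (Real.contDiffAt_log.2 hs.ne')
  · have hd : HasDerivAt (fun s => H (Real.log s)) (h (Real.log s) * s⁻¹) s :=
      (H_deriv (Real.log s)).comp s (Real.hasDerivAt_log hs.ne')
    rw [hd.deriv]
    have hqs := q_pos (Real.log s)
    have hle : q (Real.log s) ≤ ρ s := by
      simp only [hq, Real.exp_log hs]
      exact min_le_left _ _
    have heq : h (Real.log s) * s⁻¹ = 1 / q (Real.log s) := by
      simp only [hh, Real.exp_log hs]
      field_simp
    rw [heq, div_mul_eq_mul_div, one_mul]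
    exact ⟨by positivity, (one_le_div hqs).2 hle⟩
  · rw [if_neg hr.not_ge, ← Real.log_le_iff_le_exp hs, e.le_symm_apply]
    exact hrst

/-! ### Absolutely continuous functions and the comparison principle. -/

section AbsolutelyContinuous

variable {E P : Type*} [NormedAddCommGroup E] [NormedSpace ℝ E]
  [NormedAddCommGroup P] [NormedSpace ℝ P]

/-- The composition of an absolutely continuous curve with a `C¹` function. -/
theorem AbsolutelyContinuousOnInterval.contDiffAt_comp {x : ℝ → E} {φ : E → P} {a b : ℝ}
    (hx : AbsolutelyContinuousOnInterval x a b)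
    (hφ : ∀ t ∈ uIcc a b, ContDiffAt ℝ 1 φ (x t)) :
    AbsolutelyContinuousOnInterval (fun t => φ (x t)) a b := by
  -- The curve has compact image, so local Lipschitz bounds for φ merge into one constant, which
  -- scales the sums of increments.
  have hloc : LocallyLipschitzOn (x '' uIcc a b) φ := by
    rintro _ ⟨t, ht, rfl⟩
    obtain ⟨K, s, hs, hK⟩ := (hφ t ht).exists_lipschitzOnWith
    exact ⟨K, s, mem_nhdsWithin_of_mem_nhds hs, hK⟩
  obtain ⟨K, hK⟩ := hloc.exists_lipschitzOnWith_of_compact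
    (isCompact_uIcc.image_of_continuousOn hx.continuousOn)
  rw [AbsolutelyContinuousOnInterval] at hx ⊢
  have hx' := hx.const_mul (K : ℝ)
  rw [mul_zero] at hx'
  refine tendsto_of_tendsto_of_tendsto_of_le_of_le' tendsto_const_nhds hx'
    (Eventually.of_forall fun _ => Finset.sum_nonneg fun _ _ => dist_nonneg) ?_
  filter_upwards [mem_inf_of_right (mem_principal_self _)] with I hI
  rw [Finset.mul_sum]
  refine Finset.sum_le_sum fun i hi => ?_
  exact hK.dist_le_mul _ (mem_image_of_mem x (hI.1 i hi).1) _ (mem_image_of_mem x (hI.1 i hi).2)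

theorem AbsolutelyContinuousOnInterval.sub_le_of_ae_deriv_le {g : ℝ → ℝ} {a b c : ℝ}
    (hab : a ≤ b) (hg : AbsolutelyContinuousOnInterval g a b)
    (hc : ∀ᵐ t, t ∈ Ioc a b → deriv g t ≤ c) : g b - g a ≤ c * (b - a) := by
  rw [← hg.integral_deriv_eq_sub]
  have h : ∫ t in a..b, deriv g t ≤ ∫ _ in a..b, c := by
    rw [intervalIntegral.integral_of_le hab, intervalIntegral.integral_of_le hab]
    exact setIntegral_mono_ae_restrict hg.intervalIntegrable_deriv.1
      (intervalIntegrable_const (μ := volume) (a := a) (b := b)).1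
      ((ae_restrict_iff' measurableSet_Ioc).2 hc)
  refine h.trans_eq ?_
  rw [intervalIntegral.integral_const, smul_eq_mul, mul_comm]

/-- An absolutely continuous function that does not increase above the level `M` does not cross
this level upwards. -/
theorem AbsolutelyContinuousOnInterval.le_of_ae_deriv_nonpos {v : ℝ → ℝ} {a b M : ℝ}
    (hab : a ≤ b) (hv : AbsolutelyContinuousOnInterval v a b)
    (hd : ∀ᵐ t, t ∈ Ioc a b → M < v t → deriv v t ≤ 0) (ha : v a ≤ M) : v b ≤ M := by
  by_contra! hb
  have hcont : ContinuousOn v (Icc a b) := by simpa [uIcc_of_le hab] using hv.continuousOn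
  -- The last time in `S` is the last time at or below M; afterwards v stays above M, hence does not
  -- increase.
  set S : Set ℝ := Icc a b ∩ v ⁻¹' Iic M with hS
  have hSc : IsCompact S :=
    isCompact_Icc.of_isClosed_subset (hcont.preimage_isClosed_of_isClosed isClosed_Icc isClosed_Iic)
      inter_subset_left
  obtain ⟨s, hs, hmax⟩ := hSc.exists_isGreatest ⟨a, ⟨le_rfl, hab⟩, ha⟩
  have habove : ∀ t ∈ Ioc s b, M < v t := fun t ht => by
    by_contra! h
    exact ht.1.not_ge (hmax ⟨⟨hs.1.1.trans ht.1.le, ht.2⟩, h⟩)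
  have hvs : AbsolutelyContinuousOnInterval v s b := hv.mono (by
    rw [uIcc_of_le hab, uIcc_of_le hs.1.2]
    exact Icc_subset_Icc_left hs.1.1)
  have := hvs.sub_le_of_ae_deriv_le hs.1.2 (c := 0) (by
    filter_upwards [hd] with t ht hts
    exact ht ⟨hs.1.1.trans_lt hts.1, hts.2⟩ (habove t hts))
  have hsM : v s ≤ M := hs.2
  linarith

/-- A comparison principle: `β` bounds all absolutely continuous functions with `v' ≤ -ρ(v)` above
the level `M`, until this level is reached. -/
theorem IsClassKInf.exists_comparison {ρ : ℝ → ℝ} (hρ : IsClassKInf ρ) :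
    ∃ β : ℝ → ℝ → ℝ, IsClassKLInf β ∧ ∀ (v : ℝ → ℝ) (M T : ℝ), 0 ≤ M → 0 ≤ T →
      AbsolutelyContinuousOnInterval v 0 T →
      (∀ᵐ t, t ∈ Ioc 0 T → M < v t → ∃ v', HasDerivAt v v' t ∧ v' ≤ -ρ (v t)) →
      v T ≤ max (β (v 0) T) M := by
  obtain ⟨η, β, hβ, hη, hη', hηβ⟩ := hρ.exists_decay
  refine ⟨β, hβ, fun v M T hM hT hv hd => ?_⟩
  by_cases hreach : ∃ s ∈ Icc 0 T, v s ≤ M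
  · obtain ⟨s, hs, hsM⟩ := hreach
    refine le_max_of_le_right (AbsolutelyContinuousOnInterval.le_of_ae_deriv_nonpos hs.2
      (hv.mono ?_) ?_ hsM)
    · rw [uIcc_of_le hT, uIcc_of_le hs.2]
      exact Icc_subset_Icc_left hs.1
    · filter_upwards [hd] with t ht hts htM
      obtain ⟨v', hv', hle⟩ := ht ⟨hs.1.trans_lt hts.1, hts.2⟩ htM
      rw [hv'.deriv]
      exact hle.trans (neg_nonpos.2 (hρ.nonneg (hM.trans htM.le)))
  · push Not at hreach
    refine le_max_of_le_left ?_
    have hpos : ∀ t ∈ Icc 0 T, 0 < v t := fun t ht => hM.trans_lt (hreach t ht)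
    refine hηβ _ _ _ (hpos 0 ⟨le_rfl, hT⟩) (hpos T ⟨hT, le_rfl⟩) ?_
    have hac : AbsolutelyContinuousOnInterval (fun t => η (v t)) 0 T :=
      hv.contDiffAt_comp fun t ht => hη _ (hpos t (by rwa [uIcc_of_le hT] at ht))
    have := hac.sub_le_of_ae_deriv_le hT (c := -1) (by
      filter_upwards [hd] with t ht htT
      have htT' := Ioc_subset_Icc_self htT
      obtain ⟨v', hv', hle⟩ := ht htT (hreach t htT')
      have hηd := ((hη _ (hpos t htT')).differentiableAt one_ne_zero).hasDerivAt
      have hd : HasDerivAt (fun t => η (v t)) (deriv η (v t) * v') t := hηd.comp t hv'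
      rw [hd.deriv]
      obtain ⟨h1, h2⟩ := hη' _ (hpos t htT')
      have := mul_le_mul_of_nonneg_left hle h1.le
      linarith)
    linarith

end AbsolutelyContinuous

/-! ### From a control Lyapunov function to projection to state stability. -/

section ProjectionToState

variable {E F G : Type*} [NormedAddCommGroup E] [NormedSpace ℝ E] [NormedAddCommGroup G]
  {X : Set E} {V : E → ℝ}

theorem IsCLF.isDynamicProjection {U : Set F} {g : E → F → E} (hV : IsCLF X U g V) :
    IsDynamicProjection X V := by
  obtain ⟨hC, h0, αlow, αup, α, hlow, hup, -, h⟩ := hV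
  refine ⟨hC, αlow, αup, hlow, hup, fun x hx => ?_⟩
  rw [Real.norm_of_nonneg (h0 x hx)]
  exact ⟨(h x hx).1, (h x hx).2.1⟩

/-- The infimum need not be attained, but at x ≠ 0 halving the positive rate leaves room for an
actual input. -/
theorem IsCLF.exists_isCLFController [Nonempty F] {U : Set F} {g : E → F → E} (hV : IsCLF X U g V) :
    ∃ k : E → F, IsCLFController X U g V k := by
  obtain ⟨-, -, αlow, αup, α, -, -, hα, h⟩ := hV
  have hex : ∀ x ∈ X, ∃ u ∈ U, x ≠ 0 → fderiv ℝ V x (g x u) ≤ -(1 / 2 * α ‖x‖) := by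
    intro x hx
    have hlt : ∀ c : ℝ, -α ‖x‖ < c → ∃ u ∈ U, fderiv ℝ V x (g x u) < c := by
      intro c hc
      have := (h x hx).2.2.trans_lt (EReal.coe_lt_coe_iff.2 hc)
      simp only [iInf_lt_iff, EReal.coe_lt_coe_iff] at this
      obtain ⟨u, hu, huc⟩ := this
      exact ⟨u, hu, huc⟩
    by_cases hx0 : x = 0
    · obtain ⟨u, hu, -⟩ := hlt (-α ‖x‖ + 1) (lt_add_one _)
      exact ⟨u, hu, fun h => absurd hx0 h⟩
    · have hpos := hα.pos (norm_pos_iff.2 hx0)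
      obtain ⟨u, hu, huc⟩ := hlt (-(1 / 2 * α ‖x‖)) (by linarith)
      exact ⟨u, hu, fun _ => huc.le⟩
  choose! k hk hk' using hex
  exact ⟨k, hk, fun r => 1 / 2 * α r, hα.const_mul one_half_pos, hk'⟩

theorem IsCLF.isPSS {U : Set F} {f : E → F → G → E} {D : Set G} {k : E → F}
    (hV : IsCLF X U (fun x u => f x u 0) V)
    (hk : IsCLFController X U (fun x u => f x u 0) V k) : IsPSS X D f k V := by
  obtain ⟨hC, hV0, αlow, αup, _, hlow, hup, -, hbd⟩ := hV
  obtain ⟨-, α, hα, hkα⟩ := hk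
  obtain ⟨low, hlow', low_left, -⟩ := hlow.exists_inverse
  obtain ⟨up, hup', up_left, -⟩ := hup.exists_inverse
  have hρ : IsClassKInf fun r => α (up r) := hα.comp hup'
  obtain ⟨γ, hγ, -, hργ⟩ := hρ.exists_inverse
  obtain ⟨β, hβ, hcomp⟩ := (hρ.const_mul one_half_pos).exists_comparison
  refine ⟨_, _, hβ.comp hlow' hup, hlow'.comp (hγ.comp (IsClassKInf.id.const_mul two_pos)), ?_⟩
  intro T x d hsol _ hfin t ht
  set δ := essSupNorm T fun τ => projDisturbance f V (x τ) (k (x τ)) (d τ) with hδ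
  have hδ0 : 0 ≤ 2 * δ.toReal := by positivity
  have hsub : ∀ s ∈ Icc 0 t, s ∈ timeInterval T := fun s hs =>
    ⟨hs.1, (EReal.coe_le_coe_iff.2 hs.2).trans_lt ht.2⟩
  have hX : ∀ s ∈ Icc 0 t, x s ∈ X := fun s hs => hsol.mem_state s (hsub s hs)
  have hM : 0 ≤ γ (2 * δ.toReal) := hγ.nonneg hδ0
  have hle : V (x t) ≤ max (β (V (x 0)) t) (γ (2 * δ.toReal)) := by
    refine hcomp (fun s => V (x s)) _ t hM ht.1 ?_ ?_
    · refine (hsol.absCont t ht).contDiffAt_comp fun s hs => hC _ (hX s ?_)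
      rwa [uIcc_of_le ht.1] at hs
    · have hsubset : Ioc 0 t ⊆ timeInterval T := fun s hs => hsub s (Ioc_subset_Icc_self hs)
      have hae : ∀ᵐ s ∂volume.restrict (timeInterval T),
          HasDerivAt x (f (x s) (k (x s)) (d s)) s ∧
            ‖projDisturbance f V (x s) (k (x s)) (d s)‖ₑ ≤ δ := by
        filter_upwards [hsol.hasDerivAt, ENNReal.ae_le_essSup
          (fun s => ‖projDisturbance f V (x s) (k (x s)) (d s)‖ₑ)] with s h1 h2 using ⟨h1, h2⟩
      filter_upwards [(ae_restrict_iff' measurableSet_Ioc).1 (ae_restrict_of_ae_restrict_of_subset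
        hsubset hae)] with s hs hst hsM
      obtain ⟨hder, hdist⟩ := hs hst
      have hxs := hX s (Ioc_subset_Icc_self hst)
      obtain ⟨-, hVup, -⟩ := hbd _ hxs
      have hVpos : 0 < V (x s) := hM.trans_lt hsM
      -- The decay of `k` is only assumed off the origin; V > M ≥ 0 excludes the origin.
      have hx0 : x s ≠ 0 := by
        intro h0
        rw [h0, norm_zero, hup.map_zero, ← h0] at hVup
        exact hVup.not_gt hVpos
      refine ⟨_, ((hC _ hxs).differentiableAt one_ne_zero).hasFDerivAt.comp_hasDerivAt s hder, ?_⟩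
      have hsplit : fderiv ℝ V (x s) (f (x s) (k (x s)) (d s)) =
          fderiv ℝ V (x s) (f (x s) (k (x s)) 0) +
            projDisturbance f V (x s) (k (x s)) (d s) := by
        rw [projDisturbance, map_sub]
        ring
      have hnom := hkα _ hxs hx0
      have hδs : projDisturbance f V (x s) (k (x s)) (d s) ≤ δ.toReal := by
        refine (Real.le_norm_self _).trans ?_
        rw [← toReal_enorm]
        exact ENNReal.toReal_mono hfin.ne hdist
      have hup_le : up (V (x s)) ≤ ‖x s‖ := by
        rw [← up_left _ (norm_nonneg (x s))]
        exact hup'.mono hVpos.le hVup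
      have hα_le : α (up (V (x s))) ≤ α ‖x s‖ := hα.mono (hup'.nonneg hVpos.le) hup_le
      -- V > M gives ρ(V) ≥ 2‖δ‖∞, so -ρ(V) + ‖δ‖∞ ≤ -ρ(V)/2.
      have hρ_le := hρ.mono hM hsM.le
      rw [hργ _ hδ0] at hρ_le
      linarith
  have h0 : (0 : ℝ) ∈ Icc 0 t := ⟨le_rfl, ht.1⟩
  have ht' : t ∈ Icc 0 t := ⟨ht.1, le_rfl⟩
  have hβt := hβ.classKInf t ht.1
  have hβle : β (V (x 0)) t ≤ β (αup ‖x 0‖) t := hβt.mono (hV0 _ (hX 0 h0)) (hbd _ (hX 0 h0)).2.1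
  have hβ0 : 0 ≤ β (αup ‖x 0‖) t := hβt.nonneg (hup.nonneg (norm_nonneg _))
  have hlow_le : ‖x t‖ ≤ low (V (x t)) := by
    rw [← low_left _ (norm_nonneg (x t))]
    exact hlow'.mono (hlow.nonneg (norm_nonneg _)) (hbd _ (hX t ht')).1
  refine hlow_le.trans ?_
  rcases le_max_iff.1 hle with hle | hle
  · exact (hlow'.mono (hV0 _ (hX t ht')) (hle.trans hβle)).trans
      (le_add_of_nonneg_right (hlow'.nonneg hM))
  · exact (hlow'.mono (hV0 _ (hX t ht')) hle).trans
      (le_add_of_nonneg_left (hlow'.nonneg hβ0))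

end ProjectionToState

theorem corollary1 {n m p : ℕ}
    (X : Set (EuclideanSpace ℝ (Fin n))) (U : Set (EuclideanSpace ℝ (Fin m)))
    (D : Set (EuclideanSpace ℝ (Fin p)))
    (f : EuclideanSpace ℝ (Fin n) → EuclideanSpace ℝ (Fin m) → EuclideanSpace ℝ (Fin p) →
      EuclideanSpace ℝ (Fin n))
    (V : EuclideanSpace ℝ (Fin n) → ℝ)
    (hX : IsPathConnected X) (hX0 : (0 : EuclideanSpace ℝ (Fin n)) ∈ X)
    (hD0 : (0 : EuclideanSpace ℝ (Fin p)) ∈ D)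
    (hf : LocallyLipschitzOn (X ×ˢ (U ×ˢ D))
      (fun q : EuclideanSpace ℝ (Fin n) × EuclideanSpace ℝ (Fin m) × EuclideanSpace ℝ (Fin p) =>
        f q.1 q.2.1 q.2.2))
    (hV : IsCLF X U (fun x u => f x u 0) V) :
    IsDynamicProjection X V ∧
    (∀ x ∈ X, ∀ u ∈ U, ∀ d ∈ D,
      projDisturbance f V x u d = inner ℝ (gradient V x) (f x u d - f x u 0)) ∧
    (∃ k : EuclideanSpace ℝ (Fin n) → EuclideanSpace ℝ (Fin m),
      IsCLFController X U (fun x u => f x u 0) V k ∧ IsPSS X D f k V) ∧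
    (∀ k : EuclideanSpace ℝ (Fin n) → EuclideanSpace ℝ (Fin m),
      IsCLFController X U (fun x u => f x u 0) V k → IsPSS X D f k V) := by
  exact ⟨hV.isDynamicProjection, fun x _ u _ d _ => InnerProductSpace.toDual_symm_apply.symm,
    hV.exists_isCLFController.imp fun k hk => ⟨hk, hV.isPSS hk⟩, fun k hk => hV.isPSS hk⟩
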